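/- For a complete, cocomplete, closed symmetric monoidal category $\mathsf C$ let $\mathrm{Aff}_{\mathsf C}$ be the opposite of the category $\mathrm{Mon}_{\mathsf C}$ of commutative monoid objects of $\mathsf C$, and write $\operatorname{Spec} V$ for the object given by $V$. For a morphism $V\to W$ of monoids let $-\otimes_V W\colon V\text{-}\mathrm{Mod}\to W\text{-}\mathrm{Mod}$ be the base change functor, left adjoint to the forgetful functor. A morphism $\operatorname{Spec} W\to\operatorname{Spec} V$ is *flat* if $-\otimes_V W$ is exact (preserves finite limits and finite colimits); it is *an epimorphism* if $\operatorname{Hom}(W,Z)\to\operatorname{Hom}(V,Z)$ is injective for every $Z$ in $\mathrm{Mon}_{\mathsf C}$; it is *of finite presentation* if $\operatorname{Hom}_{V/\mathrm{Mon}_{\mathsf C}}(W,-)$ preserves filtered colimits. A family $\{\operatorname{Spec} W_j\to\operatorname{Spec} V\}_{j\in J}$ is *conservative* if the functor $\prod_{j\in J}(-\otimes_V W_j)\colon V\text{-}\mathrm{Mod}\to\prod_{j\in J}W_j\text{-}\mathrm{Mod}$ reflects isomorphisms. A family is a *Zariski cover* if all its members are flat epimorphisms of finite presentation and some finite subfamily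 is conservative. Let $\mathsf{Set}_*$ be the category of pointed sets with the smash product $\wedge$. Let $\widetilde{\mathsf B}$ be the category whose objects are pairs $(X,\ \mathbb N[X]\to M)$, where $X$ is a pointed set, $M$ is a commutative monoid (written additively), $\mathbb N[X]$ is the free commutative monoid on the pointed set $X$ (base point $=0$), and $\mathbb N[X]\to M$ is a surjective homomorphism; morphisms are pairs consisting of a pointed map and a monoid homomorphism that are compatible. Its tensor product is $(X,\mathbb N[X]\to M)\otimes(X',\mathbb N[X']\to M')=(X\wedge X',\ \mathbb N[X\wedge X']\cong\mathbb N[X]\otimes\mathbb N[X']\to M\otimes M')$. The symmetric monoidal functor $(X,\mathbb N[X]\to M)\mapsto X$ induces a functor on commutative monoid objects and hence a functor $\rho\colon\mathrm{Aff}_{\widetilde{\mathsf B}}\to\mathrm{Aff}_{\mathsf{Set}_*}$. **Proposition.** The functor $\rho$ sends Zariski covers to Zariski covers. More precisely, it also satisfies each of the following: 1. $\rho$ sends flat morphisms to flat morphisms; 2. $\rho$ sends finite conservative families to conservative families; 3. $\rho$ sends epimorphisms (in the above sense) to epimorphisms; 4. $\rho$ sends morphisms of finite presentation to morphisms of finite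 presentation. -/

import Mathlib

open CategoryTheory MonoidalCategory Limits Opposite

universe w v u

namespace RelativeGeometry

section General

variable (C : Type u) [Category.{v} C] [MonoidalCategory C] [BraidedCategory C]

/-- Affine schemes over a symmetric monoidal category `C`: the opposite of the category of
commutative monoid objects of `C`. The scheme `Spec V` is `op V`. -/
abbrev Aff : Type _ := (CommMon C)ᵒᵖ

variable {C}

/-- The category of modules in `C` over the commutative monoid `V`, where `X = Spec V`. -/
abbrev ModOver (X : Aff C) : Type _ := Mod C X.unop.X

instance isMonHom_hom_hom {V W : CommMon C} (f : V ⟶ W) :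
    IsMonHom (M := V.X) (N := W.X) f.hom.hom :=
  f.hom.isMonHom_hom

/-- For `f : Spec W ⟶ Spec V`, the forgetful functor from `W`-modules to `V`-modules. -/
abbrev restrictScalars {X Y : Aff C} (f : X ⟶ Y) : ModOver X ⥤ ModOver Y :=
  Mod.comap (A := Y.unop.X) (B := X.unop.X) f.unop.hom.hom

/-- `F` is a base change functor `- ⊗_V W` from `V`-modules to `W`-modules along
`f : Spec W ⟶ Spec V`, that is, a left adjoint of the forgetful functor. Such a functor is unique
up to isomorphism; it exists whenever `C` is closed and cocomplete. -/
def IsBaseChange {X Y : Aff C} (f : X ⟶ Y) (F : ModOver Y ⥤ ModOver X) : Prop :=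
  Nonempty (F ⊣ restrictScalars f)

/-- `f : Spec W ⟶ Spec V` is flat if the base change functor `- ⊗_V W` is exact. -/
def IsFlat {X Y : Aff C} (f : X ⟶ Y) : Prop :=
  ∃ F : ModOver Y ⥤ ModOver X,
    IsBaseChange f F ∧ PreservesFiniteLimits F ∧ PreservesFiniteColimits F

/-- `f : Spec W ⟶ Spec V` is an epimorphism in the sense of relative geometry: for all `Z`, the
map `Hom(W, Z) → Hom(V, Z)` between sets of morphisms of monoids is injective. -/
def IsEpimorphism {X Y : Aff C} (f : X ⟶ Y) : Prop :=
  ∀ Z : CommMon C, Function.Injective fun g : X.unop ⟶ Z => f.unop ≫ g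

/-- `f : Spec W ⟶ Spec V` is of finite presentation: the functor `Hom(W, -)` on the category of
commutative monoids under `V` preserves (small) filtered colimits. -/
def IsOfFinitePresentation {X Y : Aff C} (f : X ⟶ Y) : Prop :=
  MorphismProperty.isFinitelyPresentable.{v} (CommMon C) f.unop

/-- A family `f j : Spec (W j) ⟶ Spec V` is conservative if the functor
`∏ j, (- ⊗_V W j)` from `V`-modules to the product of the categories of `W j`-modules reflects
isomorphisms. -/
def IsConservativeFamily {J : Type w} {Y : Aff C} {X : J → Aff C} (f : ∀ j, X j ⟶ Y) : Prop :=
  ∃ F : ∀ j, ModOver Y ⥤ ModOver (X j),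
    (∀ j, IsBaseChange (f j) (F j)) ∧ (Functor.pi' F).ReflectsIsomorphisms

/-- An open Zariski immersion is a flat epimorphism of finite presentation. -/
structure IsOpenZariskiImmersion {X Y : Aff C} (f : X ⟶ Y) : Prop where
  flat : IsFlat f
  epi : IsEpimorphism f
  finitePresentation : IsOfFinitePresentation f

/-- Flat covers: families of flat morphisms, some finite subfamily of which is conservative. -/
structure IsFlatCover {J : Type w} {Y : Aff C} {X : J → Aff C} (f : ∀ j, X j ⟶ Y) : Prop where
  flat : ∀ j, IsFlat (f j)
  conservative : ∃ J' : Finset J, IsConservativeFamily fun j : J' => f j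

/-- Zariski covers: flat covers consisting of open Zariski immersions. -/
structure IsZariskiCover {J : Type w} {Y : Aff C} {X : J → Aff C} (f : ∀ j, X j ⟶ Y) : Prop where
  flatCover : IsFlatCover f
  openImmersion : ∀ j, IsOpenZariskiImmersion (f j)

end General

/-! ### Pointed sets with the smash product -/

namespace Smash

/-- The equivalence relation on `X × Y` collapsing the pairs with a base point as one of their
entries to a single class. -/
def setoid (X Y : Pointed.{u}) : Setoid (X × Y) where
  r p q := p = q ∨ ((p.1 = X.point ∨ p.2 = Y.point) ∧ (q.1 = X.point ∨ q.2 = Y.point))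
  iseqv :=
    { refl := fun _ => Or.inl rfl
      symm := by
        rintro p q (rfl | ⟨h, h'⟩)
        · exact Or.inl rfl
        · exact Or.inr ⟨h', h⟩
      trans := by
        rintro p q r (rfl | ⟨h, h'⟩) (rfl | ⟨k, k'⟩)
        · exact Or.inl rfl
        · exact Or.inr ⟨k, k'⟩
        · exact Or.inr ⟨h, h'⟩
        · exact Or.inr ⟨h, k'⟩ }

/-- The smash product of two pointed sets. -/
def obj (X Y : Pointed.{u}) : Pointed.{u} :=
  ⟨Quotient (setoid X Y), Quotient.mk _ (X.point, Y.point)⟩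

variable {X Y Z X' Y' : Pointed.{u}}

/-- The class of the pair `(x, y)` in the smash product. -/
def mk (x : X) (y : Y) : obj X Y := Quotient.mk (setoid X Y) (x, y)

theorem mk_left (y : Y) : mk X.point y = (obj X Y).point :=
  Quotient.sound (Or.inr ⟨Or.inl rfl, Or.inl rfl⟩)

theorem mk_right (x : X) : mk x Y.point = (obj X Y).point :=
  Quotient.sound (Or.inr ⟨Or.inr rfl, Or.inl rfl⟩)

theorem ind {p : obj X Y → Prop} (h : ∀ x y, p (mk x y)) (a : obj X Y) : p a :=
  Quotient.ind (fun q => h q.1 q.2) a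

/-- A map of two variables which vanishes when one of them does, as a map on the smash product. -/
def liftFun {T : Type w} (t : T) (f : X → Y → T) (h₁ : ∀ y, f X.point y = t)
    (h₂ : ∀ x, f x Y.point = t) : obj X Y → T :=
  Quotient.lift (fun p : X × Y => f p.1 p.2) (by
    rintro ⟨x, y⟩ ⟨x', y'⟩ (h | ⟨h, h'⟩)
    · rw [h]
    · have e : f x y = t := by
        rcases h with h | h
        · exact (congrArg (f · y) h).trans (h₁ y)
        · exact (congrArg (f x) h).trans (h₂ x)
      have e' : f x' y' = t := by
        rcases h' with h | h
        · exact (congrArg (f · y') h).trans (h₁ y')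
        · exact (congrArg (f x') h).trans (h₂ x')
      exact e.trans e'.symm)

/-- The pointed map on the smash product given by a bipointed map. -/
def lift (f : X → Y → Z) (h₁ : ∀ y, f X.point y = Z.point) (h₂ : ∀ x, f x Y.point = Z.point) :
    obj X Y ⟶ Z :=
  Pointed.Hom.mk (liftFun Z.point f h₁ h₂) (h₁ Y.point)

theorem hom_ext {f g : obj X Y ⟶ Z} (h : ∀ x y, f.toFun (mk x y) = g.toFun (mk x y)) : f = g :=
  Pointed.Hom.ext (funext (ind h))

/-- The smash product of two pointed maps. -/
def map (f : X ⟶ X') (g : Y ⟶ Y') : obj X Y ⟶ obj X' Y' :=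
  lift (fun x y => mk (f.toFun x) (g.toFun y))
    (fun y => by rw [f.map_point, mk_left]) (fun x => by rw [g.map_point, mk_right])

/-- The pointed set with two elements. -/
def unit : Pointed.{u} := ⟨ULift Bool, ⟨false⟩⟩

/-- The associativity isomorphism `(x ∧ y) ∧ z ↦ x ∧ (y ∧ z)`. -/
def assoc (X Y Z : Pointed.{u}) : obj (obj X Y) Z ≅ obj X (obj Y Z) where
  hom := lift
    (fun a z => liftFun (obj X (obj Y Z)).point (fun x y => mk x (mk y z))
      (fun y => mk_left _) (fun x => by rw [mk_left, mk_right]) a)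
    (fun z => mk_left _)
    (ind fun x y => by
      change mk x (mk y Z.point) = _
      rw [mk_right, mk_right])
  inv := lift
    (fun x a => liftFun (obj (obj X Y) Z).point (fun y z => mk (mk x y) z)
      (fun z => by rw [mk_right, mk_left]) (fun y => mk_right _) a)
    (ind fun y z => by
      change mk (mk X.point y) z = _
      rw [mk_left, mk_left])
    (fun x => mk_right _)
  hom_inv_id := hom_ext fun a z => by
    induction a using ind with
    | h x y => rfl
  inv_hom_id := hom_ext fun x a => by
    induction a using ind with
    | h y z => rfl

/-- The isomorphism `1 ∧ x ↦ x`. -/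
def leftUnitor (X : Pointed.{u}) : obj unit X ≅ X where
  hom := lift (fun b x => if b.down then x else X.point) (fun _ => rfl)
    (fun b => ite_self _)
  inv := Pointed.Hom.mk (fun x => mk (X := unit) ⟨true⟩ x) (mk_right _)
  hom_inv_id := hom_ext fun b x => by
    rcases b with ⟨_ | _⟩
    · exact (mk_right (X := unit) (Y := X) ⟨true⟩).trans (mk_left (X := unit) x).symm
    · rfl
  inv_hom_id := rfl

/-- The symmetry `x ∧ y ↦ y ∧ x`. -/
def swap (X Y : Pointed.{u}) : obj X Y ≅ obj Y X where
  hom := lift (fun x y => mk y x) (fun _ => mk_right _) (fun _ => mk_left _)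
  inv := lift (fun x y => mk y x) (fun _ => mk_right _) (fun _ => mk_left _)
  hom_inv_id := hom_ext fun _ _ => rfl
  inv_hom_id := hom_ext fun _ _ => rfl

/-- The isomorphism `x ∧ 1 ↦ x`. -/
def rightUnitor (X : Pointed.{u}) : obj X unit ≅ X := swap X unit ≪≫ leftUnitor X

end Smash

instance : MonoidalCategoryStruct Pointed.{u} where
  tensorObj := Smash.obj
  tensorHom f g := Smash.map f g
  whiskerLeft X _ _ g := Smash.map (𝟙 X) g
  whiskerRight f Y := Smash.map f (𝟙 Y)
  tensorUnit := Smash.unit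
  associator := Smash.assoc
  leftUnitor := Smash.leftUnitor
  rightUnitor := Smash.rightUnitor

instance : MonoidalCategory Pointed.{u} where
  tensorHom_def _ _ := Smash.hom_ext fun _ _ => rfl
  id_tensorHom_id _ _ := Smash.hom_ext fun _ _ => rfl
  tensorHom_comp_tensorHom _ _ _ _ := Smash.hom_ext fun _ _ => rfl
  whiskerLeft_id _ _ := Smash.hom_ext fun _ _ => rfl
  id_whiskerRight _ _ := Smash.hom_ext fun _ _ => rfl
  associator_naturality _ _ _ := Smash.hom_ext fun a z => by
    induction a using Smash.ind with
    | h x y => rfl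
  leftUnitor_naturality f := Smash.hom_ext fun b x => by
    rcases b with ⟨_ | _⟩
    · exact f.map_point.symm
    · rfl
  rightUnitor_naturality f := Smash.hom_ext fun x b => by
    rcases b with ⟨_ | _⟩
    · exact f.map_point.symm
    · rfl
  pentagon _ _ _ _ := Smash.hom_ext fun a z => by
    induction a using Smash.ind with
    | h a y =>
      induction a using Smash.ind with
      | h w x => rfl
  triangle X Y := Smash.hom_ext fun a y => by
    induction a using Smash.ind with
    | h x b =>
      rcases b with ⟨_ | _⟩
      · exact (Smash.mk_right (X := X) (Y := Y) x).trans (Smash.mk_left (X := X) y).symm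
      · rfl

instance : SymmetricCategory Pointed.{u} where
  braiding := Smash.swap
  braiding_naturality_right _ _ _ _ := Smash.hom_ext fun _ _ => rfl
  braiding_naturality_left _ _ := Smash.hom_ext fun _ _ => rfl
  hexagon_forward _ _ _ := Smash.hom_ext fun a z => by
    induction a using Smash.ind with
    | h x y => rfl
  hexagon_reverse _ _ _ := Smash.hom_ext fun x a => by
    induction a using Smash.ind with
    | h y z => rfl
  symmetry _ _ := Smash.hom_ext fun _ _ => rfl

/-! ### The category of generating maps from pointed sets to commutative monoids -/

/-- The category `B̃`: an object consists of a pointed set `X`, a commutative monoid `M` (written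
additively) and a surjective morphism `ℕ[X] → M`, where `ℕ[X]` is the free commutative monoid on
the pointed set `X`, the base point being identified with the neutral element. By the universal
property of `ℕ[X]` such a morphism is a map `gen : X → M` sending the base point to `0`, and it is
surjective if and only if `M` is generated by the values of `gen`. -/
structure NB : Type (u + 1) where
  X : Pointed.{u}
  M : Type u
  [addCommMonoid : AddCommMonoid M]
  gen : X → M
  gen_point : gen X.point = 0
  closure_range : AddSubmonoid.closure (Set.range gen) = ⊤

namespace NB

attribute [instance] NB.addCommMonoid

/-- A morphism is a commutative square, that is, a pair of compatible maps. -/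
@[ext]
structure Hom (A B : NB.{u}) : Type u where
  fst : A.X ⟶ B.X
  snd : A.M →+ B.M
  comm : ∀ x, snd (A.gen x) = B.gen (fst.toFun x)

instance : Category NB.{u} where
  Hom := Hom
  id A := ⟨𝟙 A.X, AddMonoidHom.id A.M, fun _ => rfl⟩
  comp f g := ⟨f.fst ≫ g.fst, g.snd.comp f.snd, fun x =>
    (congrArg g.snd (f.comm x)).trans (g.comm _)⟩

theorem hom_ext {A B : NB.{u}} {f g : A ⟶ B} (h : f.fst = g.fst) : f = g := by
  refine Hom.ext h (AddMonoidHom.eq_of_eqOn_denseM A.closure_range ?_)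
  rintro _ ⟨x, rfl⟩
  rw [f.comm, g.comm, h]

/-- The functor `(X, ℕ[X] → M) ↦ X`. -/
def toPointed : NB.{u} ⥤ Pointed.{u} where
  obj A := A.X
  map f := f.fst

instance : toPointed.{u}.Faithful where
  map_injective h := hom_ext h

/-- An isomorphism from mutually inverse maps of pointed sets, compatible with maps of monoids. -/
def mkIso {A B : NB.{u}} (e : A.X ≅ B.X) (f : A.M →+ B.M) (g : B.M →+ A.M)
    (hf : ∀ x, f (A.gen x) = B.gen (e.hom.toFun x))
    (hg : ∀ x, g (B.gen x) = A.gen (e.inv.toFun x)) : A ≅ B where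
  hom := ⟨e.hom, f, hf⟩
  inv := ⟨e.inv, g, hg⟩
  hom_inv_id := hom_ext e.hom_inv_id
  inv_hom_id := hom_ext e.inv_hom_id

open scoped TensorProduct

/-- The tensor product `(X ∧ Y, ℕ[X ∧ Y] ≅ ℕ[X] ⊗ ℕ[Y] → M ⊗ N)`, where `M ⊗ N` is the tensor
product of commutative monoids. -/
def tensor (A B : NB.{u}) : NB.{u} where
  X := A.X ⊗ B.X
  M := A.M ⊗[ℕ] B.M
  gen := Smash.liftFun 0 (fun x y => A.gen x ⊗ₜ B.gen y)
    (fun y => by rw [A.gen_point, TensorProduct.zero_tmul])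
    (fun x => by rw [B.gen_point, TensorProduct.tmul_zero])
  gen_point := by
    change A.gen A.X.point ⊗ₜ[ℕ] B.gen B.X.point = 0
    rw [A.gen_point, TensorProduct.zero_tmul]
  closure_range := by
    rw [eq_top_iff]
    rintro t -
    induction t using TensorProduct.induction_on with
    | zero => exact zero_mem _
    | add a b ha hb => exact add_mem ha hb
    | tmul m n =>
      have hm : m ∈ AddSubmonoid.closure (Set.range A.gen) := by
        rw [A.closure_range]; trivial
      have hn : n ∈ AddSubmonoid.closure (Set.range B.gen) := by
        rw [B.closure_range]; trivial
      induction hm using AddSubmonoid.closure_induction with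
      | zero => rw [TensorProduct.zero_tmul]; exact zero_mem _
      | add a b _ _ ha hb => rw [TensorProduct.add_tmul]; exact add_mem ha hb
      | mem a ha =>
        obtain ⟨x, rfl⟩ := ha
        induction hn using AddSubmonoid.closure_induction with
        | zero => rw [TensorProduct.tmul_zero]; exact zero_mem _
        | add a b _ _ ha hb => rw [TensorProduct.tmul_add]; exact add_mem ha hb
        | mem b hb =>
          obtain ⟨y, rfl⟩ := hb
          exact AddSubmonoid.subset_closure ⟨Smash.mk x y, rfl⟩

/-- The tensor product of two morphisms. -/
def tensorMap {A B A' B' : NB.{u}} (f : A ⟶ A') (g : B ⟶ B') : tensor A B ⟶ tensor A' B' where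
  fst := f.fst ⊗ₘ g.fst
  snd := (TensorProduct.map f.snd.toNatLinearMap g.snd.toNatLinearMap).toAddMonoidHom
  comm := Smash.ind fun x y => by
    change f.snd (A.gen x) ⊗ₜ[ℕ] g.snd (B.gen y) = A'.gen _ ⊗ₜ[ℕ] B'.gen _
    rw [f.comm, g.comm]

/-- The unit object `(S⁰, ℕ[S⁰] = ℕ)`. -/
def unit : NB.{u} where
  X := 𝟙_ Pointed.{u}
  M := ULift.{u} ℕ
  gen b := ⟨if b.down then 1 else 0⟩
  gen_point := rfl
  closure_range := by
    rw [eq_top_iff]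
    rintro ⟨n⟩ -
    induction n with
    | zero => exact zero_mem _
    | succ n ih => exact add_mem ih (AddSubmonoid.subset_closure ⟨⟨true⟩, rfl⟩)

/-- The associativity isomorphism. -/
def assoc (A B C : NB.{u}) : tensor (tensor A B) C ≅ tensor A (tensor B C) :=
  mkIso (α_ A.X B.X C.X)
    (TensorProduct.assoc ℕ A.M B.M C.M).toLinearMap.toAddMonoidHom
    (TensorProduct.assoc ℕ A.M B.M C.M).symm.toLinearMap.toAddMonoidHom
    (Smash.ind fun a z => by
      induction a using Smash.ind with
      | h x y => rfl)
    (Smash.ind fun x a => by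
      induction a using Smash.ind with
      | h y z => rfl)

/-- The symmetry isomorphism. -/
def swap (A B : NB.{u}) : tensor A B ≅ tensor B A :=
  mkIso (β_ A.X B.X)
    (TensorProduct.comm ℕ A.M B.M).toLinearMap.toAddMonoidHom
    (TensorProduct.comm ℕ B.M A.M).toLinearMap.toAddMonoidHom
    (Smash.ind fun _ _ => rfl) (Smash.ind fun _ _ => rfl)

/-- The left unit isomorphism. -/
def leftUnitor (A : NB.{u}) : tensor unit A ≅ A :=
  mkIso (λ_ A.X)
    (TensorProduct.liftAddHom
      ((smulAddHom ℕ A.M).comp (AddEquiv.ulift (α := ℕ)).toAddMonoidHom)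
      (fun n x y => by simp))
    ((TensorProduct.mk ℕ (ULift.{u} ℕ) A.M ⟨1⟩).toAddMonoidHom)
    (Smash.ind fun b x => by
      rcases b with ⟨_ | _⟩
      · exact (zero_smul ℕ (A.gen x)).trans A.gen_point.symm
      · exact one_smul ℕ (A.gen x))
    (fun _ => rfl)

/-- The right unit isomorphism. -/
def rightUnitor (A : NB.{u}) : tensor A unit ≅ A := swap A unit ≪≫ leftUnitor A

instance : MonoidalCategoryStruct NB.{u} where
  tensorObj := tensor
  tensorHom f g := tensorMap f g
  whiskerLeft A _ _ g := tensorMap (𝟙 A) g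
  whiskerRight f B := tensorMap f (𝟙 B)
  tensorUnit := unit
  associator := assoc
  leftUnitor := leftUnitor
  rightUnitor := rightUnitor

/-- The monoidal operations of `B̃` lie over those of pointed sets. -/
def inducingData : Monoidal.InducingFunctorData toPointed.{u} where
  μIso _ _ := Iso.refl _
  εIso := Iso.refl _
  whiskerLeft_eq _ _ _ _ := Smash.hom_ext fun _ _ => rfl
  whiskerRight_eq _ _ := Smash.hom_ext fun _ _ => rfl
  tensorHom_eq _ _ := Smash.hom_ext fun _ _ => rfl
  associator_eq _ _ _ := Smash.hom_ext fun a z => by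
    induction a using Smash.ind with
    | h x y => rfl
  leftUnitor_eq _ := Smash.hom_ext fun _ _ => rfl
  rightUnitor_eq _ := Smash.hom_ext fun _ _ => rfl

instance : MonoidalCategory NB.{u} := Monoidal.induced toPointed inducingData

instance : toPointed.{u}.Monoidal := Monoidal.fromInducedMonoidal toPointed inducingData

instance : BraidedCategory NB.{u} :=
  BraidedCategory.ofFaithful toPointed swap fun _ _ => Smash.hom_ext fun _ _ => rfl

instance : toPointed.{u}.Braided where
  braided _ _ := Smash.hom_ext fun _ _ => rfl

instance : SymmetricCategory NB.{u} := SymmetricCategory.ofFaithful toPointed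

end NB

/-- The functor `ρ` from affine schemes over `B̃` to affine schemes over pointed sets, induced by
the forgetful functor `(A, A ⊗ ℕ → R) ↦ A` on commutative monoid objects. -/
def rho : Aff NB.{u} ⥤ Aff Pointed.{u} := NB.toPointed.mapCommMon.op

end RelativeGeometry

/-!
The functor `X ↦ (X, 0)` from pointed sets to `B̃` is fully faithful, lax symmetric monoidal and
right adjoint to `(X, M) ↦ X`. It therefore induces right adjoints of the forgetful functors on
commutative monoids, on commutative monoids under a fixed one and on modules, each of which embeds
the structures over pointed sets as the reflective subcategory of the structures over `B̃` with zero
monoid. All four properties of a morphism `(A, R) → (B, S)` pass to `A → B` by being tested on such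
structures.

* For modules, the key point is `subsingleton_baseChange`: the base change of `(X, 0)` again has
  zero monoid. In formulas it is `(X ⊗_A B, 0 ⊗_R S)`, but this description is not needed: the unit
  `(X, 0) → F (X, 0)` has its values among the elements that `gen` sends to `0`, and these form a
  submodule `(zeroPart N, 0)` of `N = F (X, 0)`, so that by the universal property the identity of
  `N` factors through an object with zero monoid. Hence base change along `(A, R) → (B, S)` restricts
  to a base change `L` along `A → B` (`exists_isBaseChange_rho_map`). As `X ↦ (X, 0)` preserves and
  reflects limits and isomorphisms, `L` inherits exactness, and families of such functors inherit
  conservativity.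
* Epimorphisms are treated by the adjunction on commutative monoids.
* For finite presentation it suffices that the right adjoint `Z ↦ (Z, 0)` on commutative monoids
  under a fixed one preserves filtered colimits. A semiring receiving a homomorphism from the zero
  ring is zero, so the image of this functor is a cosieve, and the inclusion of a full subcategory
  which is a cosieve preserves nonempty colimits (`preservesColimitsOfShape_of_cosieve`).
-/

/-! ### Full subcategories -/

namespace CategoryTheory

/-- Restriction of an adjunction `L' ⊣ R'` to full subcategories (embedded by `iC` and `iD`), the
second of which is reflective and contains the values of `L'` on the first: the left adjoint `L` is
the corestriction of `iC ⋙ L'`. -/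
lemma exists_restricted_leftAdjoint {C D C' D' : Type*} [Category* C] [Category* D]
    [Category* C'] [Category* D'] {iC : C ⥤ C'} {iD : D ⥤ D'} {L' : C' ⥤ D'} {R' : D' ⥤ C'}
    {R : D ⥤ C} (adj : L' ⊣ R') (hiC : iC.FullyFaithful) [Reflective iD]
    (comm : iD ⋙ R' ≅ R ⋙ iC) (h : ∀ X, iD.essImage (L'.obj (iC.obj X))) :
    ∃ L : C ⥤ D, Nonempty (L ⊣ R) ∧ Nonempty (iC ⋙ L' ≅ L ⋙ iD) := by
  have := fun X ↦ Functor.essImage.unit_isIso (h X)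
  let e : iC ⋙ L' ≅ (iC ⋙ L' ⋙ reflector iD) ⋙ iD :=
    NatIso.ofComponents (fun X ↦ asIso ((reflectorAdjunction iD).unit.app (L'.obj (iC.obj X))))
      fun f ↦ (reflectorAdjunction iD).unit.naturality (L'.map (iC.map f))
  exact ⟨_, ⟨adj.restrictFullyFaithful hiC (.ofFullyFaithful iD) e comm⟩, ⟨e⟩⟩

/-- The inclusion of a full subcategory which is a cosieve preserves nonempty colimits. -/
lemma preservesColimitsOfShape_of_cosieve {C D : Type*} [Category* C] [Category* D]
    (R : D ⥤ C) [R.Full] [R.Faithful] (h : ∀ ⦃X Y⦄, (R.obj X ⟶ Y) → R.essImage Y)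
    (J : Type*) [Category* J] [Nonempty J] : PreservesColimitsOfShape J R where
  preservesColimit {K} := ⟨fun {c} hc ↦ by
    refine ⟨IsColimit.ofExistsUnique fun s ↦ ?_⟩
    -- One leg of `s` suffices to move the whole cocone into the subcategory.
    obtain ⟨Y, ⟨e⟩⟩ := h (s.ι.app (Classical.arbitrary J))
    let t : Cocone K :=
      { pt := Y
        ι := { app j := R.preimage (s.ι.app j ≫ e.inv)
               naturality i j f := R.map_injective (by simpa using s.w_assoc f e.inv) } }
    refine ⟨R.map (hc.desc t) ≫ e.hom, fun j ↦ ?_, fun m hm ↦ ?_⟩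
    · simp [← Functor.map_comp_assoc, hc.fac, t]
    · rw [← Iso.comp_inv_eq]
      refine (R.map_preimage _).symm.trans (congrArg R.map (hc.uniq t _ fun j ↦ R.map_injective ?_))
      simp [t, ← hm]⟩

end CategoryTheory

namespace RelativeGeometry

namespace NB

/-! ### Objects with zero monoid -/

/-- The object `(X, 0)` of `B̃`. -/
def zeroMonoid (X : Pointed.{u}) : NB.{u} where
  X := X
  M := PUnit
  gen _ := 0
  gen_point := rfl
  closure_range := Subsingleton.elim _ _

instance (X : Pointed.{u}) : Subsingleton (zeroMonoid X).M := inferInstanceAs (Subsingleton PUnit)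

/-- The morphism to an object with zero monoid given by a map of pointed sets. -/
def homOfSubsingleton {A B : NB.{u}} [Subsingleton B.M] (f : A.X ⟶ B.X) : A ⟶ B where
  fst := f
  snd := 0
  comm _ := Subsingleton.elim _ _

/-- The functor `X ↦ (X, 0)`. -/
def ofPointed : Pointed.{u} ⥤ NB.{u} where
  obj := zeroMonoid
  map f := homOfSubsingleton f

instance (X : Pointed.{u}) : Subsingleton (ofPointed.obj X).M :=
  inferInstanceAs (Subsingleton PUnit)

/-- `X ↦ (X, 0)` is right adjoint to `(X, M) ↦ X`. -/
def toPointedAdj : toPointed.{u} ⊣ ofPointed where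
  unit := { app A := homOfSubsingleton (B := ofPointed.obj A.X) (𝟙 A.X) }
  counit := { app X := 𝟙 X }

instance : ofPointed.{u}.LaxMonoidal where
  ε := homOfSubsingleton (B := ofPointed.obj _) (𝟙 _)
  μ X Y := homOfSubsingleton (B := ofPointed.obj _) (𝟙 (X ⊗ Y))
  μ_natural_left _ _ := hom_ext rfl
  μ_natural_right _ _ := hom_ext rfl
  associativity _ _ _ := hom_ext (Smash.hom_ext fun a z => by
    induction a using Smash.ind with
    | h x y => rfl)
  left_unitality _ := hom_ext (Smash.hom_ext fun _ _ => rfl)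
  right_unitality _ := hom_ext (Smash.hom_ext fun _ _ => rfl)

instance : ofPointed.{u}.LaxBraided where
  braided _ _ := hom_ext (Smash.hom_ext fun _ _ => rfl)

instance : toPointedAdj.{u}.IsMonoidal where
  leftAdjoint_ε := hom_ext rfl
  leftAdjoint_μ _ _ := hom_ext (Smash.hom_ext fun _ _ => rfl)

lemma isIso_of_isIso_fst {A B : NB.{u}} [Subsingleton A.M] [Subsingleton B.M] (f : A ⟶ B)
    [IsIso f.fst] : IsIso f :=
  ⟨homOfSubsingleton (inv f.fst), hom_ext (IsIso.hom_inv_id f.fst),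
    hom_ext (IsIso.inv_hom_id f.fst)⟩

/-! ### Commutative monoids -/

open scoped MonObj TensorProduct

/-- On commutative monoid objects, `A ↦ (A, 0)` is right adjoint to `(A, R) ↦ A`. -/
def commMonAdj : toPointed.{u}.mapCommMon ⊣ ofPointed.mapCommMon := toPointedAdj.mapCommMon

instance (X : CommMon Pointed.{u}) : IsIso (commMonAdj.counit.app X) := by
  have : IsIso ((CommMon.forget₂Mon _ ⋙ Mon.forget _).map (commMonAdj.counit.app X)) := by
    have : (CommMon.forget₂Mon _ ⋙ Mon.forget _).map (commMonAdj.counit.app X) = 𝟙 X.X := rfl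
    exact this ▸ IsIso.id X.X
  exact isIso_of_reflects_iso _ (CommMon.forget₂Mon _ ⋙ Mon.forget _)

lemma isIso_commMonAdj_unit_app (A : CommMon NB.{u}) [Subsingleton A.X.M] :
    IsIso (commMonAdj.unit.app A) := by
  have : IsIso ((CommMon.forget₂Mon _ ⋙ Mon.forget _).map (commMonAdj.unit.app A)) := by
    let g : A.X ⟶ ofPointed.obj A.X.X := homOfSubsingleton (𝟙 A.X.X)
    have : IsIso g.fst := IsIso.id A.X.X
    exact isIso_of_isIso_fst g
  exact isIso_of_reflects_iso _ (CommMon.forget₂Mon _ ⋙ Mon.forget _)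

/-- In a semiring which receives a homomorphism from the zero ring, `1 = 0`, so it is zero. -/
lemma subsingleton_of_hom {A B : CommMon NB.{u}} [Subsingleton A.X.M] (f : A ⟶ B) :
    Subsingleton B.X.M := by
  -- `η` sends the generator `1` of `ℕ` to the unit element of the semiring.
  have h : (η[B.X] : 𝟙_ NB ⟶ B.X).snd (⟨1⟩ : ULift ℕ) = 0 := by
    have := congrArg (fun g : 𝟙_ NB ⟶ B.X => g.snd (⟨1⟩ : ULift ℕ)) (IsMonHom.one_hom f.hom.hom)
    refine this.symm.trans ?_
    exact (congrArg f.hom.hom.snd (Subsingleton.elim (α := A.X.M) _ 0)).trans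
      (map_zero f.hom.hom.snd)
  refine subsingleton_of_forall_eq 0 fun m => ?_
  have := congrArg (fun g : 𝟙_ NB ⊗ B.X ⟶ B.X => g.snd ((⟨1⟩ : ULift ℕ) ⊗ₜ[ℕ] m))
    (MonObj.one_mul B.X)
  refine ((one_smul ℕ m).symm.trans this.symm).trans ?_
  change (μ[B.X] : B.X ⊗ B.X ⟶ B.X).snd ((η[B.X] : 𝟙_ NB ⟶ B.X).snd (⟨1⟩ : ULift ℕ) ⊗ₜ[ℕ] m) = 0
  rw [h]
  exact (congrArg _ (TensorProduct.zero_tmul _ _)).trans (map_zero _)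

/-- The embedding `(A → Z) ↦ ((A, R) → (Z, 0))` of commutative monoids under `A` into those under
`(A, R)`. -/
abbrev ofPointedUnder (V : CommMon NB.{u}) :
    Under (toPointed.mapCommMon.obj V) ⥤ Under V :=
  Under.post ofPointed.mapCommMon ⋙ Under.map (commMonAdj.unit.app V)

/-- On commutative monoids under a fixed one, `Z ↦ (Z, 0)` is right adjoint to `(Z, S) ↦ Z`. -/
abbrev underAdj (V : CommMon NB.{u}) : Under.post toPointed.mapCommMon ⊣ ofPointedUnder V :=
  Under.postAdjunctionLeft commMonAdj

instance (V : CommMon NB.{u}) : IsIso (underAdj V).counit := by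
  have (Z : Under (toPointed.mapCommMon.obj V)) : IsIso ((underAdj V).counit.app Z) := by
    have : IsIso ((Under.forget _).map ((underAdj V).counit.app Z)) :=
      inferInstanceAs (IsIso (commMonAdj.counit.app Z.right))
    exact isIso_of_reflects_iso _ (Under.forget _)
  exact NatIso.isIso_of_isIso_app _

instance (V : CommMon NB.{u}) : (ofPointedUnder V).Full :=
  (underAdj V).fullyFaithfulROfIsIsoCounit.full

instance (V : CommMon NB.{u}) : (ofPointedUnder V).Faithful :=
  (underAdj V).fullyFaithfulROfIsIsoCounit.faithful

instance (V : CommMon NB.{u}) (J : Type*) [Category* J] [Nonempty J] :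
    PreservesColimitsOfShape J (ofPointedUnder V) :=
  preservesColimitsOfShape_of_cosieve _ (fun X Y f => by
    have : Subsingleton ((ofPointedUnder V).obj X).right.X.M :=
      inferInstanceAs (Subsingleton PUnit)
    have := subsingleton_of_hom f.right
    have := isIso_commMonAdj_unit_app Y.right
    have : IsIso ((Under.forget _).map ((underAdj V).unit.app Y)) := this
    have := isIso_of_reflects_iso ((underAdj V).unit.app Y) (Under.forget _)
    exact ⟨_, ⟨(asIso ((underAdj V).unit.app Y)).symm⟩⟩) J

/-! ### Modules -/

open scoped MonoidalLeftAction

variable (Y : Aff NB.{u})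

/-- The functor `(X, M) ↦ X` from modules over `(A, R)` to modules over `A`. -/
def toPointedMod : ModOver Y ⥤ ModOver (rho.obj Y) where
  obj N :=
    { X := N.X.X
      mod :=
        { smul := (γ[Y.unop.X, N.X] : Y.unop.X ⊗ N.X ⟶ N.X).fst
          one_smul := congrArg Hom.fst (ModObj.one_smul (M := Y.unop.X) N.X)
          mul_smul := congrArg Hom.fst (ModObj.mul_smul (M := Y.unop.X) N.X) } }
  map f := Mod.Hom.mk' f.hom.fst
    (congrArg Hom.fst (IsModHom.smul_hom (A := Y.unop.X) (f := f.hom)))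

/-- The functor `X ↦ (X, 0)` from modules over `A` to modules over `(A, R)`. -/
def ofPointedMod : ModOver (rho.obj Y) ⥤ ModOver Y where
  obj N :=
    { X := zeroMonoid N.X
      mod :=
        { smul := homOfSubsingleton (A := Y.unop.X ⊗ zeroMonoid N.X) (B := zeroMonoid N.X)
            γ[(rho.obj Y).unop.X, N.X]
          one_smul := hom_ext (ModObj.one_smul (M := (rho.obj Y).unop.X) N.X)
          mul_smul := hom_ext (ModObj.mul_smul (M := (rho.obj Y).unop.X) N.X) } }
  map f := Mod.Hom.mk' (homOfSubsingleton (B := zeroMonoid _) f.hom)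
    (hom_ext (IsModHom.smul_hom (A := (rho.obj Y).unop.X) (f := f.hom)))

/-- On modules, `X ↦ (X, 0)` is right adjoint to `(X, M) ↦ X`. -/
def modAdj : toPointedMod Y ⊣ ofPointedMod Y where
  unit :=
    { app N := Mod.Hom.mk' (homOfSubsingleton (B := zeroMonoid _) (𝟙 N.X.X))
        (hom_ext (Smash.hom_ext fun _ _ => rfl))
      naturality _ _ _ := Mod.hom_ext _ _ (hom_ext rfl) }
  counit :=
    { app N := 𝟙 N
      naturality _ _ _ := Mod.hom_ext _ _ rfl }
  left_triangle_components _ := Mod.hom_ext _ _ rfl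
  right_triangle_components _ := Mod.hom_ext _ _ (hom_ext rfl)

instance : IsIso (modAdj Y).counit := by
  have (N : ModOver (rho.obj Y)) : IsIso ((modAdj Y).counit.app N) :=
    IsIso.id N
  exact NatIso.isIso_of_isIso_app _

instance : Reflective (ofPointedMod Y) where
  L := _
  adj := modAdj Y
  toFaithful := (modAdj Y).fullyFaithfulROfIsIsoCounit.faithful
  toFull := (modAdj Y).fullyFaithfulROfIsIsoCounit.full

variable {Y}

lemma mem_essImage_ofPointedMod (N : ModOver Y) [Subsingleton N.X.M] :
    (ofPointedMod Y).essImage N :=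
  ⟨(toPointedMod Y).obj N, ⟨{
    hom := Mod.Hom.mk' (homOfSubsingleton (A := zeroMonoid N.X.X) (𝟙 N.X.X))
      (hom_ext (Smash.hom_ext fun _ _ => rfl))
    inv := (modAdj Y).unit.app N
    hom_inv_id := Mod.hom_ext _ _ (hom_ext rfl)
    inv_hom_id := Mod.hom_ext _ _ (hom_ext rfl) }⟩⟩

lemma gen_smul_eq_zero (N : ModOver Y) (a : Y.unop.X.X) {x : N.X.X} (hx : N.X.gen x = 0) :
    N.X.gen ((γ[Y.unop.X, N.X] : Y.unop.X ⊗ N.X ⟶ N.X).fst.toFun (Smash.mk a x)) = 0 := by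
  refine ((γ[Y.unop.X, N.X] : Y.unop.X ⊗ N.X ⟶ N.X).comm (Smash.mk a x)).symm.trans ?_
  change (γ[Y.unop.X, N.X] : Y.unop.X ⊗ N.X ⟶ N.X).snd (Y.unop.X.gen a ⊗ₜ[ℕ] N.X.gen x) = 0
  rw [hx]
  exact (congrArg _ (TensorProduct.tmul_zero _ _)).trans (map_zero _)

/-- For a module `N = (X, M)` over `(A, R)`, the sub-`A`-set of `X` consisting of the elements
which `gen` sends to `0`. -/
def zeroPart (N : ModOver Y) : ModOver (rho.obj Y) where
  X := ⟨{x : N.X.X // N.X.gen x = 0}, ⟨N.X.X.point, N.X.gen_point⟩⟩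
  mod :=
    { smul := Smash.lift (X := Y.unop.X.X)
        (fun a x => ⟨(γ[Y.unop.X, N.X] : Y.unop.X ⊗ N.X ⟶ N.X).fst.toFun (Smash.mk a x.1),
          gen_smul_eq_zero N a x.2⟩)
        (fun x => Subtype.ext ((congrArg _ (Smash.mk_left x.1)).trans (Pointed.Hom.map_point _)))
        (fun a => Subtype.ext ((congrArg _ (Smash.mk_right a)).trans (Pointed.Hom.map_point _)))
      one_smul := Smash.hom_ext fun b x => Subtype.ext (by
        rcases b with ⟨_ | _⟩ <;>
        exact congrArg
          (fun g : 𝟙_ NB ⊗ N.X ⟶ N.X => g.fst.toFun (Smash.mk (X := Smash.unit) _ x.1))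
          (ModObj.one_smul (M := Y.unop.X) N.X))
      mul_smul := Smash.hom_ext fun p x => Subtype.ext (by
        induction p using Smash.ind with
        | h a b =>
          exact congrArg (fun g : (Y.unop.X ⊗ Y.unop.X) ⊗ N.X ⟶ N.X =>
            g.fst.toFun (Smash.mk (Smash.mk a b) x.1)) (ModObj.mul_smul (M := Y.unop.X) N.X)) }

/-- The inclusion of `(zeroPart N, 0)` into `N`. -/
def zeroPartInclusion (N : ModOver Y) : (ofPointedMod Y).obj (zeroPart N) ⟶ N :=
  Mod.Hom.mk'
    (⟨⟨Subtype.val, rfl⟩, 0, fun x => x.2.symm⟩ : zeroMonoid (zeroPart N).X ⟶ N.X)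
    (hom_ext (Smash.hom_ext fun _ _ => rfl))

end NB

/-! ### Base change and the functor `ρ` -/

/-- Restriction of scalars commutes with `X ↦ (X, 0)`. -/
def ofPointedModRestrictScalars {X Y : Aff NB.{u}} (f : X ⟶ Y) :
    NB.ofPointedMod X ⋙ restrictScalars f ≅
      restrictScalars (rho.map f) ⋙ NB.ofPointedMod Y :=
  NatIso.ofComponents (fun N =>
    { hom := Mod.Hom.mk' (𝟙 (NB.zeroMonoid N.X)) (NB.hom_ext (Smash.hom_ext fun _ _ => rfl))
      inv := Mod.Hom.mk' (𝟙 (NB.zeroMonoid N.X)) (NB.hom_ext (Smash.hom_ext fun _ _ => rfl))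
      hom_inv_id := Mod.hom_ext _ _ rfl
      inv_hom_id := Mod.hom_ext _ _ rfl })
    fun _ => Mod.hom_ext _ _ rfl

/-- Base change along `(A, R) → (B, S)` preserves modules with zero monoid. -/
lemma subsingleton_baseChange {X Y : Aff NB.{u}} {f : X ⟶ Y} {F : ModOver Y ⥤ ModOver X}
    (adj : F ⊣ restrictScalars f) (Z : ModOver (rho.obj Y)) :
    Subsingleton (F.obj ((NB.ofPointedMod Y).obj Z)).X.M := by
  set N := F.obj ((NB.ofPointedMod Y).obj Z)
  let u := adj.unit.app ((NB.ofPointedMod Y).obj Z)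
  have hu (z : Z.X) : N.X.gen (u.hom.fst.toFun z) = 0 :=
    (u.hom.comm z).symm.trans (map_zero u.hom.snd)
  -- The unit `u` corestricted to `zeroPart N`.
  let v : (NB.ofPointedMod Y).obj Z ⟶
      (restrictScalars f).obj ((NB.ofPointedMod X).obj (NB.zeroPart N)) :=
    Mod.Hom.mk' (NB.homOfSubsingleton (A := NB.zeroMonoid Z.X)
        (B := NB.zeroMonoid (NB.zeroPart N).X)
        ⟨fun z => ⟨u.hom.fst.toFun z, hu z⟩, Subtype.ext u.hom.fst.map_point⟩)
      (NB.hom_ext (Smash.hom_ext fun a z => Subtype.ext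
        (congrArg (fun g => g.fst.toFun (Smash.mk a z))
          (IsModHom.smul_hom (A := Y.unop.X) (f := u.hom)))))
  let w := (adj.homEquiv _ _).symm v
  have hw : w ≫ NB.zeroPartInclusion N = 𝟙 N := by
    apply (adj.homEquiv _ _).injective
    rw [adj.homEquiv_naturality_right, Equiv.apply_symm_apply, adj.homEquiv_id]
    exact Mod.hom_ext _ _ (NB.hom_ext rfl)
  refine subsingleton_of_forall_eq 0 fun m => ?_
  -- On monoids `zeroPartInclusion N` is `0`, and `w ≫ zeroPartInclusion N` is the identity.
  exact (congrArg (fun g : N ⟶ N => g.hom.snd m) hw).symm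

/-- A base change functor along `f` restricts to one along `ρ f` on modules with zero monoid. -/
theorem exists_isBaseChange_rho_map {X Y : Aff NB.{u}} {f : X ⟶ Y} {F : ModOver Y ⥤ ModOver X}
    (hF : IsBaseChange f F) : ∃ L, IsBaseChange (rho.map f) L ∧
      Nonempty (NB.ofPointedMod Y ⋙ F ≅ L ⋙ NB.ofPointedMod X) :=
  let ⟨adj⟩ := hF
  exists_restricted_leftAdjoint adj (.ofFullyFaithful _) (ofPointedModRestrictScalars f) fun Z =>
    have := subsingleton_baseChange adj Z
    NB.mem_essImage_ofPointedMod _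

theorem isFlat_rho_map {X Y : Aff NB.{u}} (f : X ⟶ Y) (hf : IsFlat f) : IsFlat (rho.map f) := by
  obtain ⟨F, hF, _, -⟩ := hf
  obtain ⟨L, hL, ⟨e⟩⟩ := exists_isBaseChange_rho_map hF
  have := (NB.modAdj Y).rightAdjoint_preservesLimits.{0, 0}
  refine ⟨L, hL, ⟨fun J _ _ => ?_⟩, ⟨fun J _ _ => ?_⟩⟩
  · have := preservesLimitsOfShape_of_natIso (J := J) e
    exact preservesLimitsOfShape_of_reflects_of_preserves L (NB.ofPointedMod X)
  · obtain ⟨adj⟩ := hL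
    have := adj.leftAdjoint_preservesColimits.{0, 0}
    infer_instance

theorem isConservativeFamily_rho_map {J : Type w} {Y : Aff NB.{u}} {X : J → Aff NB.{u}}
    (f : ∀ j, X j ⟶ Y) (hf : IsConservativeFamily f) :
    IsConservativeFamily fun j => rho.map (f j) := by
  obtain ⟨F, hF, _⟩ := hf
  choose L hL e using fun j => exists_isBaseChange_rho_map (hF j)
  refine ⟨L, hL, ⟨fun {M N} u hu => ?_⟩⟩
  have : IsIso ((Functor.pi' F).map ((NB.ofPointedMod Y).map u)) := by
    rw [isIso_pi_iff] at hu ⊢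
    intro j
    obtain ⟨e⟩ := e j
    have : IsIso ((L j).map u) := hu j
    exact (NatIso.isIso_map_iff e u).2
      (inferInstanceAs (IsIso ((NB.ofPointedMod _).map ((L j).map u))))
  have := isIso_of_reflects_iso ((NB.ofPointedMod Y).map u) (Functor.pi' F)
  exact isIso_of_reflects_iso u (NB.ofPointedMod Y)

theorem isOfFinitePresentation_rho_map {X Y : Aff NB.{u}} (f : X ⟶ Y)
    (hf : IsOfFinitePresentation f) : IsOfFinitePresentation (rho.map f) := by
  have := Cardinal.fact_isRegular_aleph0
  have : (NB.ofPointedUnder Y.unop).IsCardinalAccessible Cardinal.aleph0.{u} :=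
    ⟨fun J _ _ => by
      have := isFiltered_of_isCardinalFiltered J Cardinal.aleph0
      have : Nonempty J := IsFiltered.nonempty
      infer_instance⟩
  have : IsCardinalPresentable (Under.mk f.unop) Cardinal.aleph0.{u} := hf
  exact (NB.underAdj Y.unop).isCardinalPresentable_leftAdjoint_obj _ (Under.mk f.unop)

theorem isEpimorphism_rho_map {X Y : Aff NB.{u}} (f : X ⟶ Y)
    (hf : IsEpimorphism f) : IsEpimorphism (rho.map f) := fun _ g h e =>
  (NB.commMonAdj.homEquiv _ _).injective <| hf _ <|
    (NB.commMonAdj.homEquiv_naturality_left f.unop g).symm.trans <|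
      (congrArg (NB.commMonAdj.homEquiv _ _) e).trans <|
        NB.commMonAdj.homEquiv_naturality_left f.unop h

end RelativeGeometry

theorem mainTheorem6 :
    (∀ {J : Type w} {Y : RelativeGeometry.Aff RelativeGeometry.NB.{u}}
        {X : J → RelativeGeometry.Aff RelativeGeometry.NB.{u}} (f : ∀ j, X j ⟶ Y),
      RelativeGeometry.IsZariskiCover f →
        RelativeGeometry.IsZariskiCover fun j => RelativeGeometry.rho.map (f j)) ∧
    (∀ {X Y : RelativeGeometry.Aff RelativeGeometry.NB.{u}} (f : X ⟶ Y),
      RelativeGeometry.IsFlat f → RelativeGeometry.IsFlat (RelativeGeometry.rho.map f)) ∧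
    (∀ {J : Type w} [Finite J] {Y : RelativeGeometry.Aff RelativeGeometry.NB.{u}}
        {X : J → RelativeGeometry.Aff RelativeGeometry.NB.{u}} (f : ∀ j, X j ⟶ Y),
      RelativeGeometry.IsConservativeFamily f →
        RelativeGeometry.IsConservativeFamily fun j => RelativeGeometry.rho.map (f j)) ∧
    (∀ {X Y : RelativeGeometry.Aff RelativeGeometry.NB.{u}} (f : X ⟶ Y),
      RelativeGeometry.IsEpimorphism f →
        RelativeGeometry.IsEpimorphism (RelativeGeometry.rho.map f)) ∧
    (∀ {X Y : RelativeGeometry.Aff RelativeGeometry.NB.{u}} (f : X ⟶ Y),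
      RelativeGeometry.IsOfFinitePresentation f →
        RelativeGeometry.IsOfFinitePresentation (RelativeGeometry.rho.map f)) :=
  ⟨fun f hf =>
    have flat j := RelativeGeometry.isFlat_rho_map (f j) (hf.flatCover.flat j)
    { flatCover :=
        { flat
          conservative :=
            let ⟨J', h⟩ := hf.flatCover.conservative
            ⟨J', RelativeGeometry.isConservativeFamily_rho_map _ h⟩ }
      openImmersion j :=
        { flat := flat j
          epi := RelativeGeometry.isEpimorphism_rho_map _ (hf.openImmersion j).epi
          finitePresentation := RelativeGeometry.isOfFinitePresentation_rho_map _
            (hf.openImmersion j).finitePresentation } },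
    RelativeGeometry.isFlat_rho_map, RelativeGeometry.isConservativeFamily_rho_map,
    RelativeGeometry.isEpimorphism_rho_map, RelativeGeometry.isOfFinitePresentation_rho_map⟩
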